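/- \textbf{Definitions.} A (finite, atomic) hypergraph $\mathbf H$ consists of a finite set $H$ (its carrier) and a set $\mathbf H$ of non-empty subsets of $H$ (the hyperedges) with $\{x\}\in\mathbf H$ for all $x\in H$. For $X\subseteq H$ let $\mathbf H_X=\{Z\in\mathbf H\mid Z\subseteq X\}$, a hypergraph with carrier $X$. A hypergraph with non-empty carrier $H$ is connected if there is no partition $H=X_1\sqcup X_2$ into two non-empty sets with $\mathbf H=\mathbf H_{X_1}\cup\mathbf H_{X_2}$; a non-empty $X\subseteq H$ is connected if $\mathbf H_X$ is, and the connected components of $\mathbf H_X$ are the maximal connected subsets of $X$. Let $\mathrm{Sat}(\mathbf H)$ be the set of all non-empty connected subsets of $H$. The constructs of a connected hypergraph $\mathbf H$ are the (non-planar) rooted trees with nodes labelled by non-empty sets defined inductively as follows: for $\emptyset\ne Y\subseteq H$, if $H_1,\dots,H_n$ ($n\ge 0$) are the connected components of $\mathbf H_{H\setminus Y}$ and $T_i$ is a construct of $\mathbf H_{H_i}$ for each $i$, then the tree $Y(T_1,\dots,T_n)$, with root labelled $Y$ on which the $T_i$ are grafted, is a construct of $\mathbf H$ (for $Y=H$ it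 is the one-node tree labelled $H$). The order $\le$ on the constructs of $\mathbf H$ is the smallest partial order (defined simultaneously for all connected $\mathbf H$) such that (i) $Y(X(T_{11},\dots,T_{1m}),T_2,\dots,T_n)\le (Y\cup X)(T_{11},\dots,T_{1m},T_2,\dots,T_n)$ and (ii) $Y(T_1,T_2,\dots,T_n)\le Y(T_1',T_2,\dots,T_n)$ whenever $T_1\le T_1'$. For a construct $T$ let $\psi(T)$ be the set of all $\uparrow_T(Y)$, for $Y$ a node of $T$, where $\uparrow_T(Y)$ is the union of the labels of the descendants of $Y$ in $T$, including $Y$ itself. For non-empty $A\subseteq H$ let $\pi_A=\{x\in\mathbb R^H\mid \sum_{i\in A}x_i=3^{|A|}\}$ and $\pi_A^+=\{x\in\mathbb R^H\mid \sum_{i\in A}x_i\ge 3^{|A|}\}$, and put $$\mathcal G(\mathbf H)=\pi_H\cap\bigcap_{A\in \mathrm{Sat}(\mathbf H)\setminus\{H\}}\pi_A^+,\qquad \Pi(M)=\mathcal G(\mathbf H)\cap\bigcap_{A\in M}\pi_A\quad (M\subseteq\mathrm{Sat}(\mathbf H)).$$ A non-empty face of $\mathcal G(\mathbf H)$ is $\mathcal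 G(\mathbf H)$ itself or a non-empty intersection of $\mathcal G(\mathbf H)$ with a hyperplane bounding a closed half-space that contains $\mathcal G(\mathbf H)$; the non-empty faces are ordered by inclusion. \textbf{Theorem.} Let $\mathbf H$ be a finite, atomic, connected hypergraph. Then the map $T\mapsto\Pi(\psi(T))$ is an order-isomorphism from the poset of constructs of $\mathbf H$ onto the poset of non-empty faces of $\mathcal G(\mathbf H)$. -/

import Mathlib

open scoped Hypergraph

namespace Hypergraph

universe u

/-- A hypergraph is atomic if all singletons of vertices are hyperedges. -/
def IsAtomic {α : Type u} (H : Hypergraph α) : Prop :=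
  ∀ x ∈ V(H), {x} ∈ E(H)

/-- For a set `X` of vertices, `H.restrict X` is the hypergraph with carrier `X` whose hyperedges
are the hyperedges of `H` contained in `X`. -/
def restrict {α : Type u} (H : Hypergraph α) (X : Set α) : Hypergraph α where
  vertexSet := X
  edgeSet := {e | e ∈ E(H) ∧ e ⊆ X}
  subset_vertexSet_of_mem_edgeSet' := fun _ he => he.2

/-- A hypergraph with non-empty carrier is connected if its carrier has no partition into two
non-empty parts such that every hyperedge is contained in one of the two parts. -/
def IsConnected {α : Type u} (H : Hypergraph α) : Prop :=
  V(H).Nonempty ∧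
    ¬ ∃ X₁ X₂ : Set α, X₁.Nonempty ∧ X₂.Nonempty ∧ Disjoint X₁ X₂ ∧ X₁ ∪ X₂ = V(H) ∧
      E(H) = E(H.restrict X₁) ∪ E(H.restrict X₂)

/-- `K` is (the carrier of) a connected component of `H.restrict X`: a maximal one among the
(non-empty) connected subsets of `X`. -/
def IsComponent {α : Type u} (H : Hypergraph α) (X K : Set α) : Prop :=
  Maximal (fun L : Set α => L ⊆ X ∧ (H.restrict L).IsConnected) K

/-- `H.Construct Z` is the type of constructs of the hypergraph `H.restrict Z`, that is, of the
decorated rooted trees `Y(T₁, …, Tₙ)` obtained by choosing a non-empty `Y ⊆ Z` as the label of the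
root and grafting on it, for every connected component `K` of `H.restrict (Z \ Y)`, a construct
of `H.restrict K`. The trees are not planar: the subtrees are indexed by the components. The
one-node tree is the case `Y = Z`, where there are no components. -/
inductive Construct {α : Type u} (H : Hypergraph α) : Set α → Type u
  | node {Z : Set α} (Y : Set α) (hY : Y ⊆ Z) (hne : Y.Nonempty)
      (T : ∀ K : Set α, H.IsComponent (Z \ Y) K → Construct H K) : Construct H Z

namespace Construct

/-- The order on constructs: the least reflexive and transitive relation that contains the
contractions `Y(X(T₁₁, …, T₁ₘ), T₂, …, Tₙ) ≤ (Y ∪ X)(T₁₁, …, T₁ₘ, T₂, …, Tₙ)` of an edge at the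
root, and that is compatible with replacing one of the subtrees grafted on the root.

In `contract`, the connected components of `H.restrict (Z \ (Y ∪ X))` are the components of
`H.restrict (K \ X)` and the components other than `K` of `H.restrict (Z \ Y)`; the two conditions
on `U` say which subtree is grafted for each of them. -/
inductive Le {α : Type u} {H : Hypergraph α} :
    ∀ {Z : Set α}, H.Construct Z → H.Construct Z → Prop
  | refl {Z : Set α} (T : H.Construct Z) : Le T T
  | trans {Z : Set α} {S T U : H.Construct Z} : Le S T → Le T U → Le S U
  | contract {Z Y X K : Set α} (hY : Y ⊆ Z) (hYne : Y.Nonempty)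
      (T : ∀ L : Set α, H.IsComponent (Z \ Y) L → H.Construct L)
      (hK : H.IsComponent (Z \ Y) K) (hX : X ⊆ K) (hXne : X.Nonempty)
      (S : ∀ L : Set α, H.IsComponent (K \ X) L → H.Construct L)
      (hTK : T K hK = node X hX hXne S)
      (hYX : Y ∪ X ⊆ Z) (hYXne : (Y ∪ X).Nonempty)
      (U : ∀ L : Set α, H.IsComponent (Z \ (Y ∪ X)) L → H.Construct L)
      (hUS : ∀ (L : Set α) (hL : H.IsComponent (Z \ (Y ∪ X)) L)
        (hL' : H.IsComponent (K \ X) L), U L hL = S L hL')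
      (hUT : ∀ (L : Set α) (hL : H.IsComponent (Z \ (Y ∪ X)) L)
        (hL' : H.IsComponent (Z \ Y) L), L ≠ K → U L hL = T L hL') :
      Le (node Y hY hYne T) (node (Y ∪ X) hYX hYXne U)
  | congr {Z Y K : Set α} (hY : Y ⊆ Z) (hYne : Y.Nonempty)
      (T T' : ∀ L : Set α, H.IsComponent (Z \ Y) L → H.Construct L)
      (hK : H.IsComponent (Z \ Y) K) (hle : Le (T K hK) (T' K hK))
      (heq : ∀ (L : Set α) (hL : H.IsComponent (Z \ Y) L), L ≠ K → T L hL = T' L hL) :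
      Le (node Y hY hYne T) (node Y hY hYne T')

instance {α : Type u} {H : Hypergraph α} {Z : Set α} : Preorder (H.Construct Z) where
  le := Le
  le_refl := Le.refl
  le_trans := fun _ _ _ => Le.trans

/-- The union of the labels of all the nodes of a construct. -/
def labelUnion {α : Type u} {H : Hypergraph α} : ∀ {Z : Set α}, H.Construct Z → Set α
  | _, node Y _ _ T => Y ∪ {x | ∃ K hK, x ∈ (T K hK).labelUnion}

/-- `ψ(T)`: the set of all `↑(Y)`, for `Y` a node of `T`, where `↑(Y)` is the union of the labels
of the descendants of `Y` in `T` (including `Y`), that is, of the nodes of the subtree of `T`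
rooted at `Y`. -/
def psi {α : Type u} {H : Hypergraph α} : ∀ {Z : Set α}, H.Construct Z → Set (Set α)
  | _, node Y hY hne T =>
      {(node Y hY hne T).labelUnion} ∪ {A | ∃ K hK, A ∈ (T K hK).psi}

end Construct

/-- The saturation of `H`: the set of all non-empty connected subsets of the carrier. -/
def Sat {α : Type u} (H : Hypergraph α) : Set (Set α) :=
  {X | X.Nonempty ∧ X ⊆ V(H) ∧ (H.restrict X).IsConnected}

/-- The half-space `∑_{i ∈ A} xᵢ ≥ 3^|A|`. -/
def halfSpace {α : Type u} (H : Hypergraph α) (A : Set α) : Set (V(H) → ℝ) :=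
  {x | (3 : ℝ) ^ A.ncard ≤ ∑ᶠ i ∈ ((↑) ⁻¹' A : Set V(H)), x i}

/-- The hyperplane `∑_{i ∈ A} xᵢ = 3^|A|`. -/
def hyperplane {α : Type u} (H : Hypergraph α) (A : Set α) : Set (V(H) → ℝ) :=
  {x | ∑ᶠ i ∈ ((↑) ⁻¹' A : Set V(H)), x i = (3 : ℝ) ^ A.ncard}

/-- The geometric realisation `G(H)`. -/
def realization {α : Type u} (H : Hypergraph α) : Set (V(H) → ℝ) :=
  (⋂ A ∈ H.Sat \ {V(H)}, H.halfSpace A) ∩ H.hyperplane V(H)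

/-- `Π(M)`: the intersection of `G(H)` with the hyperplanes given by the elements of `M`. -/
def geomFace {α : Type u} (H : Hypergraph α) (M : Set (Set α)) : Set (V(H) → ℝ) :=
  (⋂ A ∈ M, H.hyperplane A) ∩ H.realization

/-- The non-empty faces of `G(H)`, ordered by inclusion: the non-empty sets of all points of `G(H)`
at which some linear form attains its maximum over `G(H)` (`G(H)` itself is given by the zero form,
and all others are the intersections of `G(H)` with a supporting hyperplane). -/
abbrev Face {α : Type u} (H : Hypergraph α) : Type u :=
  {F : Set (V(H) → ℝ) // F.Nonempty ∧ IsExposed ℝ H.realization F}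

end Hypergraph

/-! Both posets are encoded by families of connected sets, ordered by reverse inclusion.

A construct `T` is recovered from `T.psi`: its root consists of the vertices lying in no member but
the carrier, and its subtrees from the members inside each component (`psi_injective`). Contracting
an edge deletes exactly one member, which yields `le_iff_psi_subset`. The families that arise are
the nested ones containing the carrier (`exists_psi_eq`).

A point of the realization is sent to the family `tight x` of hyperplanes through it. The bound `3 ^
n` grows so fast that two incomparable tight sets have a union of mass at most `2 * 3 ^ (n - 1) < 3
^ n`, so this union is not connected; hence tight families are nested (`isNested_tight`). Conversely
each `T.psi` is the tight family of some point (`exists_tight_eq_psi`). An exposed face is cut out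
by the tight family of a generic point of it (`exists_eq_geomFace`), so faces and constructs
correspond. -/

namespace Hypergraph

universe u

variable {α : Type u} {H : Hypergraph α} {X Y Z K L A B : Set α}

/-! ### Connected sets and components -/

/-- A set `L` is connected in `H` if and only if it is non-empty and every set that does not cut
any hyperedge contained in `L` does not cut `L`. -/
theorem isConnected_restrict_iff : (H.restrict L).IsConnected ↔ L.Nonempty ∧
    ∀ S : Set α, (∀ e ∈ E(H), e ⊆ L → e ⊆ S ∨ Disjoint e S) → L ⊆ S ∨ Disjoint L S := by
  refine and_congr_right fun _ => ⟨fun h S hS => ?_, ?_⟩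
  · by_contra! hcon
    refine h ⟨L ∩ S, L \ S, Set.not_disjoint_iff_nonempty_inter.1 hcon.2,
      Set.sdiff_nonempty.2 hcon.1, disjoint_sdiff_self_right.mono_left Set.inter_subset_right,
      Set.inter_union_sdiff L S, ?_⟩
    ext e
    constructor
    · rintro ⟨he, heL⟩
      rcases hS e he heL with h | h
      · exact Or.inl ⟨⟨he, heL⟩, Set.subset_inter heL h⟩
      · exact Or.inr ⟨⟨he, heL⟩, Set.subset_sdiff.2 ⟨heL, h⟩⟩
    · rintro (h | h)
      · exact h.1
      · exact h.1
  · rintro h ⟨X₁, X₂, h₁, h₂, hd, hu, hE⟩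
    change X₁ ∪ X₂ = L at hu
    subst hu
    have hS : ∀ e ∈ E(H), e ⊆ X₁ ∪ X₂ → e ⊆ X₁ ∨ Disjoint e X₁ := by
      intro e he heL
      have : e ∈ E(H.restrict (X₁ ∪ X₂)) := ⟨he, heL⟩
      rw [hE] at this
      rcases this with h | h
      · exact Or.inl h.2
      · exact Or.inr (hd.symm.mono_left h.2)
    rcases h X₁ hS with h | h
    · obtain ⟨x, hx⟩ := h₂
      exact Set.disjoint_left.1 hd (h (Or.inr hx)) hx
    · obtain ⟨x, hx⟩ := h₁
      exact Set.disjoint_left.1 h (Or.inl hx) hx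

theorem isConnected_restrict_singleton (x : α) : (H.restrict {x}).IsConnected := by
  refine isConnected_restrict_iff.2 ⟨Set.singleton_nonempty x, fun S _ => ?_⟩
  simpa using em (x ∈ S)

theorem IsConnected.union (hA : (H.restrict A).IsConnected) (hB : (H.restrict B).IsConnected)
    (hAB : (A ∩ B).Nonempty) : (H.restrict (A ∪ B)).IsConnected := by
  rw [isConnected_restrict_iff] at *
  refine ⟨hA.1.inl, fun S hS => ?_⟩
  obtain ⟨x, hxA, hxB⟩ := hAB
  rcases hA.2 S fun e he h => hS e he (h.trans Set.subset_union_left) with h₁ | h₁ <;>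
    rcases hB.2 S fun e he h => hS e he (h.trans Set.subset_union_right) with h₂ | h₂
  · exact Or.inl (Set.union_subset h₁ h₂)
  · exact (Set.disjoint_left.1 h₂ hxB (h₁ hxA)).elim
  · exact (Set.disjoint_left.1 h₁ hxA (h₂ hxB)).elim
  · exact Or.inr (Set.disjoint_union_left.2 ⟨h₁, h₂⟩)

namespace IsComponent

theorem subset (hK : H.IsComponent X K) : K ⊆ X := hK.1.1

theorem isConnected (hK : H.IsComponent X K) : (H.restrict K).IsConnected := hK.1.2

theorem nonempty (hK : H.IsComponent X K) : K.Nonempty := hK.isConnected.1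

/-- A component contains the connected sets that meet it. -/
theorem subset_of_inter_nonempty (hK : H.IsComponent X K) (hLX : L ⊆ X)
    (hL : (H.restrict L).IsConnected) (h : (K ∩ L).Nonempty) : L ⊆ K :=
  Set.subset_union_right.trans <|
    hK.2 ⟨Set.union_subset hK.subset hLX, hK.isConnected.union hL h⟩ Set.subset_union_left

theorem eq_of_inter_nonempty (hK : H.IsComponent X K) (hL : H.IsComponent X L)
    (h : (K ∩ L).Nonempty) : K = L :=
  (hL.subset_of_inter_nonempty hK.subset hK.isConnected (Set.inter_comm K L ▸ h)).antisymm
    (hK.subset_of_inter_nonempty hL.subset hL.isConnected h)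

theorem eq_of_mem (hK : H.IsComponent X K) (hL : H.IsComponent X L) {x : α} (hxK : x ∈ K)
    (hxL : x ∈ L) : K = L :=
  hK.eq_of_inter_nonempty hL ⟨x, hxK, hxL⟩

/-- A component of a set is a component of each smaller set that contains it. -/
theorem mono (hK : H.IsComponent X K) (hYX : Y ⊆ X) (hKY : K ⊆ Y) : H.IsComponent Y K :=
  ⟨⟨hKY, hK.isConnected⟩, fun _ hL hKL => hK.2 ⟨hL.1.trans hYX, hL.2⟩ hKL⟩

end IsComponent

theorem exists_isComponent_of_subset (hX : X.Finite) (hLX : L ⊆ X)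
    (hL : (H.restrict L).IsConnected) : ∃ K, H.IsComponent X K ∧ L ⊆ K := by
  have hfin : {L : Set α | L ⊆ X ∧ (H.restrict L).IsConnected}.Finite :=
    hX.finite_subsets.subset fun _ h => h.1
  obtain ⟨K, hLK, hK⟩ := hfin.exists_le_maximal ⟨hLX, hL⟩
  exact ⟨K, hK, hLK⟩

theorem exists_isComponent_of_mem (hX : X.Finite) {x : α} (hx : x ∈ X) :
    ∃ K, H.IsComponent X K ∧ x ∈ K := by
  obtain ⟨K, hK, h⟩ := exists_isComponent_of_subset hX (Set.singleton_subset_iff.2 hx)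
    (isConnected_restrict_singleton (H := H) x)
  exact ⟨K, hK, h rfl⟩

/-- Removing a subset `X` of a component `K` of `H.restrict (Z \ Y)` keeps the other components
and replaces `K` by the components of `H.restrict (K \ X)`. -/
theorem isComponent_diff_union_iff (hZ : Z.Finite) (hK : H.IsComponent (Z \ Y) K) (hX : X ⊆ K) :
    H.IsComponent (Z \ (Y ∪ X)) L ↔
      H.IsComponent (K \ X) L ∨ (H.IsComponent (Z \ Y) L ∧ L ≠ K) := by
  have hsub : Z \ (Y ∪ X) ⊆ Z \ Y := Set.sdiff_subset_sdiff_right Set.subset_union_left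
  have hKX : K \ X ⊆ Z \ (Y ∪ X) := fun x hx =>
    ⟨(hK.subset hx.1).1, fun h => h.elim (hK.subset hx.1).2 hx.2⟩
  have hother : ∀ M, H.IsComponent (Z \ Y) M → M ≠ K → M ⊆ Z \ (Y ∪ X) := fun M hM hne x hx =>
    ⟨(hM.subset hx).1, fun h => h.elim (hM.subset hx).2
      fun h => hne (hM.eq_of_mem hK hx (hX h))⟩
  constructor
  · intro hL
    obtain ⟨M, hM, hLM⟩ :=
      exists_isComponent_of_subset (hZ.subset Set.sdiff_subset) (hL.subset.trans hsub) hL.isConnected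
    by_cases h : M = K
    · subst h
      exact Or.inl (hL.mono hKX fun x hx => ⟨hLM hx, fun h => (hL.subset hx).2 (Or.inr h)⟩)
    · have : L = M := hLM.antisymm (hL.2 ⟨hother M hM h, hM.isConnected⟩ hLM)
      exact Or.inr ⟨this ▸ hM, this ▸ h⟩
  · rintro (hL | ⟨hL, hne⟩)
    · refine ⟨⟨hL.subset.trans hKX, hL.isConnected⟩, fun M hM hLM => hL.2 ⟨?_, hM.2⟩ hLM⟩
      obtain ⟨x, hx⟩ := hL.nonempty
      have := hK.subset_of_inter_nonempty (hM.1.trans hsub) hM.2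
        ⟨x, (hL.subset hx).1, hLM hx⟩
      exact fun y hy => ⟨this hy, fun h => (hM.1 hy).2 (Or.inr h)⟩
    · exact hL.mono hsub (hother L hL hne)

/-! ### Constructs as nested families -/

/-- A set of sets is nested if it contains no family, other than one with a greatest element,
whose union is connected. -/
def IsNested (H : Hypergraph α) (M : Set (Set α)) : Prop :=
  ∀ F ⊆ M, (H.restrict (⋃₀ F)).IsConnected → ⋃₀ F ∈ F

namespace Construct

theorem labelUnion_eq (hZ : Z.Finite) (T : H.Construct Z) : T.labelUnion = Z := by
  induction T with
  | @node Z Y hY hne T ih =>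
    have hd := hZ.subset (Set.sdiff_subset (t := Y))
    rw [labelUnion]
    ext x
    constructor
    · rintro (h | ⟨K, hK, h⟩)
      · exact hY h
      · rw [ih K hK (hd.subset hK.subset)] at h
        exact (hK.subset h).1
    · intro hx
      by_cases hxY : x ∈ Y
      · exact Or.inl hxY
      · obtain ⟨K, hK, h⟩ := exists_isComponent_of_mem (H := H) hd ⟨hx, hxY⟩
        exact Or.inr ⟨K, hK, by rwa [ih K hK (hd.subset hK.subset)]⟩

theorem mem_psi_node (hZ : Z.Finite) {hY : Y ⊆ Z} {hne : Y.Nonempty}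
    {T : ∀ K : Set α, H.IsComponent (Z \ Y) K → H.Construct K} :
    A ∈ (node Y hY hne T).psi ↔ A = Z ∨ ∃ K hK, A ∈ (T K hK).psi := by
  rw [psi, labelUnion_eq hZ]
  rfl

theorem self_mem_psi (hZ : Z.Finite) (T : H.Construct Z) : Z ∈ T.psi := by
  cases T
  exact (mem_psi_node hZ).2 (Or.inl rfl)

theorem subset_of_mem_psi (hZ : Z.Finite) {T : H.Construct Z} (hA : A ∈ T.psi) : A ⊆ Z := by
  induction T with
  | @node Z Y hY hne T ih =>
    rcases (mem_psi_node hZ).1 hA with rfl | ⟨K, hK, h⟩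
    · rfl
    · have hKZ := hK.subset.trans Set.sdiff_subset
      exact (ih K hK (hZ.subset hKZ) h).trans hKZ

theorem finite_psi (hZ : Z.Finite) (T : H.Construct Z) : T.psi.Finite :=
  hZ.finite_subsets.subset fun _ hA => subset_of_mem_psi hZ hA

theorem isConnected_of_mem_psi (hZ : Z.Finite) (hc : (H.restrict Z).IsConnected)
    {T : H.Construct Z} (hA : A ∈ T.psi) : (H.restrict A).IsConnected := by
  induction T with
  | @node Z Y hY hne T ih =>
    rcases (mem_psi_node hZ).1 hA with rfl | ⟨K, hK, h⟩
    · exact hc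
    · exact ih K hK (hZ.subset (hK.subset.trans Set.sdiff_subset)) hK.isConnected h

section Node

variable {hY : Y ⊆ Z} {hne : Y.Nonempty}
  {T : ∀ K : Set α, H.IsComponent (Z \ Y) K → H.Construct K}

theorem subset_diff_of_mem_psi_child (hZ : Z.Finite) {hK : H.IsComponent (Z \ Y) K}
    (hA : A ∈ (T K hK).psi) : A ⊆ Z \ Y :=
  (subset_of_mem_psi (hZ.subset (hK.subset.trans Set.sdiff_subset)) hA).trans hK.subset

/-- Members are non-empty and components are disjoint, so a member inside `K` comes from no other
subtree; nor is it `Z`, since `K` misses the non-empty root. -/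
theorem mem_psi_child_iff (hZ : Z.Finite) (hK : H.IsComponent (Z \ Y) K) :
    A ∈ (T K hK).psi ↔ A ∈ (node Y hY hne T).psi ∧ A ⊆ K := by
  have hfin {K} (hK : H.IsComponent (Z \ Y) K) := hZ.subset (hK.subset.trans Set.sdiff_subset)
  refine ⟨fun h => ⟨(mem_psi_node hZ).2 (Or.inr ⟨K, hK, h⟩), subset_of_mem_psi (hfin hK) h⟩, ?_⟩
  rintro ⟨h, hAK⟩
  rcases (mem_psi_node hZ).1 h with rfl | ⟨L, hL, h⟩
  · obtain ⟨y, hy⟩ := hne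
    exact ((hK.subset (hAK (hY hy))).2 hy).elim
  · obtain ⟨x, hx⟩ := (isConnected_of_mem_psi (hfin hL) hL.isConnected h).1
    obtain rfl := hK.eq_of_mem hL (hAK hx) (subset_of_mem_psi (hfin hL) h hx)
    exact h

/-- Describes the root through `psi` alone: a vertex outside `Y` lies in a component, which is
itself a member different from `Z`. -/
theorem mem_root_iff (hZ : Z.Finite) {x : α} :
    x ∈ Y ↔ x ∈ Z ∧ ∀ A ∈ (node Y hY hne T).psi, x ∈ A → A = Z := by
  constructor
  · refine fun hx => ⟨hY hx, fun A hA hxA => ?_⟩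
    rcases (mem_psi_node hZ).1 hA with h | ⟨K, hK, h⟩
    · exact h
    · exact ((subset_diff_of_mem_psi_child hZ h hxA).2 hx).elim
  · rintro ⟨hx, h⟩
    by_contra hxY
    have hd := hZ.subset (Set.sdiff_subset (t := Y))
    obtain ⟨K, hK, hxK⟩ := exists_isComponent_of_mem (H := H) hd ⟨hx, hxY⟩
    have := h K ((mem_psi_node hZ).2 (Or.inr ⟨K, hK, self_mem_psi (hd.subset hK.subset) _⟩)) hxK
    obtain ⟨y, hy⟩ := hne
    exact (hK.subset (this.symm ▸ hY hy : y ∈ K)).2 hy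

end Node

theorem psi_injective (hZ : Z.Finite) : Function.Injective (psi (H := H) (Z := Z)) := by
  intro T
  induction T with
  | @node Z Y hY hne T ih =>
    rintro ⟨Y', hY', hne', T'⟩ h
    obtain rfl : Y = Y' := by
      ext x
      rw [mem_root_iff hZ (hY := hY) (hne := hne), h, ← mem_root_iff hZ]
    congr
    funext K hK
    refine ih K hK (hZ.subset (hK.subset.trans Set.sdiff_subset)) ?_
    ext A
    rw [mem_psi_child_iff hZ (hY := hY) (hne := hne), h, ← mem_psi_child_iff hZ]

theorem psi_subset_of_le (hZ : Z.Finite) {S T : H.Construct Z} (h : S ≤ T) : T.psi ⊆ S.psi := by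
  replace h : Le S T := h
  induction h with
  | refl => rfl
  | trans _ _ ih₁ ih₂ => exact (ih₂ hZ).trans (ih₁ hZ)
  | @contract Z Y X K hY hYne T hK hX hXne S hTK hYX hYXne U hUS hUT =>
    intro A hA
    rw [mem_psi_node hZ] at hA ⊢
    rcases hA with h | ⟨L, hL, h⟩
    · exact Or.inl h
    · right
      rcases (isComponent_diff_union_iff hZ hK hX).1 hL with hL' | ⟨hL', hLK⟩
      · refine ⟨K, hK, ?_⟩
        rw [hTK, mem_psi_node (hZ.subset (hK.subset.trans Set.sdiff_subset))]
        exact Or.inr ⟨L, hL', hUS L hL hL' ▸ h⟩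
      · exact ⟨L, hL', hUT L hL hL' hLK ▸ h⟩
  | @congr Z Y K hY hYne T T' hK hle heq ih =>
    intro A hA
    rw [mem_psi_node hZ] at hA ⊢
    rcases hA with h | ⟨L, hL, h⟩
    · exact Or.inl h
    · refine Or.inr ⟨L, hL, ?_⟩
      by_cases hLK : L = K
      · subst hLK
        exact ih (hZ.subset (hK.subset.trans Set.sdiff_subset)) h
      · rwa [heq L hL hLK]

theorem node_le_node (hZ : Z.Finite) {hY : Y ⊆ Z} {hne : Y.Nonempty}
    {T T' : ∀ K : Set α, H.IsComponent (Z \ Y) K → H.Construct K}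
    (h : ∀ K hK, T K hK ≤ T' K hK) : node Y hY hne T ≤ node Y hY hne T' := by
  classical
  -- `Le.congr` changes a single subtree, so the finitely many components are treated one by one.
  have key : ∀ s : Finset (Set α), node Y hY hne T ≤
      node Y hY hne (fun K hK => if K ∈ s then T' K hK else T K hK) := by
    intro s
    induction s using Finset.induction_on with
    | empty => simp
    | insert K s hKs ih =>
      refine ih.trans ?_
      by_cases hK : H.IsComponent (Z \ Y) K
      · refine Le.congr hY hne _ _ hK ?_ fun L hL hLK => ?_
        · simp only [hKs, if_false, Finset.mem_insert_self, if_true]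
          exact h K hK
        · simp [hLK]
      · refine le_of_eq ?_
        congr
        funext L hL
        have : L ≠ K := fun h => hK (h ▸ hL)
        simp [this]
  have hfin : {K | H.IsComponent (Z \ Y) K}.Finite :=
    hZ.finite_subsets.subset fun K hK => IsComponent.subset hK |>.trans Set.sdiff_subset
  convert key hfin.toFinset using 4 with K hK
  simp [hK]

/-- Contraction of the edge between the root and its child over the component `K`. -/
theorem exists_contract (hZ : Z.Finite) {hY : Y ⊆ Z} {hne : Y.Nonempty}
    {T : ∀ K : Set α, H.IsComponent (Z \ Y) K → H.Construct K} (hK : H.IsComponent (Z \ Y) K) :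
    ∃ U : H.Construct Z, node Y hY hne T ≤ U ∧ U.psi = (node Y hY hne T).psi \ {K} := by
  classical
  have hKZ : K ⊆ Z := hK.subset.trans Set.sdiff_subset
  obtain ⟨X, hX, hXne, S, hTK⟩ : ∃ X hX hXne S, T K hK = node X hX hXne S := by
    cases T K hK
    exact ⟨_, _, _, _, rfl⟩
  have hcomp {L} := isComponent_diff_union_iff (L := L) hZ hK hX
  have hYX : Y ∪ X ⊆ Z := Set.union_subset hY (hX.trans hKZ)
  let U : ∀ L : Set α, H.IsComponent (Z \ (Y ∪ X)) L → H.Construct L := fun L hL =>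
    if h : H.IsComponent (K \ X) L then S L h
    else T L ((hcomp.1 hL).resolve_left h).1
  have hUS : ∀ (L : Set α) (hL : H.IsComponent (Z \ (Y ∪ X)) L)
      (hL' : H.IsComponent (K \ X) L), U L hL = S L hL' := fun L hL hL' => dif_pos hL'
  have hUT : ∀ (L : Set α) (hL : H.IsComponent (Z \ (Y ∪ X)) L)
      (hL' : H.IsComponent (Z \ Y) L), L ≠ K → U L hL = T L hL' := by
    intro L hL hL' hLK
    refine dif_neg fun h => hLK ?_
    obtain ⟨x, hx⟩ := h.nonempty
    exact hL'.eq_of_mem hK hx (h.subset hx).1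
  have hle : node Y hY hne T ≤ node (Y ∪ X) hYX hne.inl U :=
    Le.contract hY hne T hK hX hXne S hTK hYX hne.inl U hUS hUT
  refine ⟨_, hle, Set.Subset.antisymm (fun A hA => ⟨psi_subset_of_le hZ hle hA, ?_⟩) ?_⟩
  · rintro rfl
    rcases (mem_psi_node hZ).1 hA with rfl | ⟨L, hL, h⟩
    · obtain ⟨y, hy⟩ := hne
      exact (hK.subset (hY hy)).2 hy
    · obtain ⟨x, hx⟩ := hXne
      exact (subset_diff_of_mem_psi_child hZ h (hX hx)).2 (Or.inr hx)
  · rintro A ⟨hA, hAK⟩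
    rw [mem_psi_node hZ] at hA ⊢
    rcases hA with h | ⟨L, hL, h⟩
    · exact Or.inl h
    · right
      by_cases hLK : L = K
      · subst hLK
        rw [hTK, mem_psi_node (hZ.subset hKZ)] at h
        obtain ⟨M, hM, h⟩ := h.resolve_left hAK
        have hM' := hcomp.2 (Or.inl hM)
        exact ⟨M, hM', hUS M hM' hM ▸ h⟩
      · have hL' := hcomp.2 (Or.inr ⟨hL, hLK⟩)
        exact ⟨L, hL', hUT L hL' hL hLK ▸ h⟩

/-- Induction on the number of members of `S.psi`. If the roots agree, compare the subtrees.
Otherwise the root of `T` has a vertex `z` outside the root of `S`; the component `K` containing `z`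
is not in `T.psi`, so contracting the edge to `K` keeps the inclusion. -/
theorem le_of_psi_subset {S T : H.Construct Z} (hZ : Z.Finite) (h : T.psi ⊆ S.psi) : S ≤ T := by
  induction hn : S.psi.ncard using Nat.strong_induction_on generalizing Z with
  | _ n ih =>
  subst hn
  obtain ⟨Y, hY, hne, t⟩ := S
  obtain ⟨Y', hY', hne', t'⟩ := T
  have hYY' : Y ⊆ Y' := by
    intro x hx
    rw [mem_root_iff hZ (hY := hY) (hne := hne) (T := t)] at hx
    rw [mem_root_iff hZ (hY := hY') (hne := hne') (T := t')]
    exact ⟨hx.1, fun A hA => hx.2 A (h hA)⟩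
  by_cases hcase : Y' ⊆ Y
  · obtain rfl := hYY'.antisymm hcase
    refine node_le_node hZ fun K hK =>
      ih _ ?_ (hZ.subset (hK.subset.trans Set.sdiff_subset)) ?_ rfl
    · refine Set.ncard_lt_ncard ⟨fun A hA => ((mem_psi_child_iff hZ hK).1 hA).1, fun hsub => ?_⟩
        (finite_psi hZ _)
      obtain ⟨y, hy⟩ := hne
      exact (subset_diff_of_mem_psi_child hZ (hsub (self_mem_psi hZ _)) (hY hy)).2 hy
    · intro A hA
      rw [mem_psi_child_iff hZ (hY := hY) (hne := hne)] at hA ⊢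
      exact ⟨h hA.1, hA.2⟩
  · obtain ⟨z, hz', hz⟩ := Set.not_subset.1 hcase
    obtain ⟨K, hK, hzK⟩ := exists_isComponent_of_mem (H := H)
      (hZ.subset (Set.sdiff_subset (t := Y))) ⟨hY' hz', hz⟩
    obtain ⟨U, hU, hUpsi⟩ := exists_contract hZ (hY := hY) (hne := hne) (T := t) hK
    have hKmem : K ∈ (node Y hY hne t).psi := (mem_psi_node hZ).2
      (Or.inr ⟨K, hK, self_mem_psi (hZ.subset (hK.subset.trans Set.sdiff_subset)) _⟩)
    refine hU.trans (ih _ ?_ hZ ?_ rfl)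
    · rw [hUpsi]
      exact Set.ncard_sdiff_singleton_lt_of_mem hKmem (finite_psi hZ _)
    · rw [hUpsi]
      refine fun A hA => ⟨h hA, ?_⟩
      rintro rfl
      have := ((mem_root_iff hZ).1 hz').2 _ hA hzK
      obtain ⟨y, hy⟩ := hne
      exact (hK.subset (this.symm ▸ hY hy)).2 hy

theorem le_iff_psi_subset (hZ : Z.Finite) {S T : H.Construct Z} : S ≤ T ↔ T.psi ⊆ S.psi :=
  ⟨psi_subset_of_le hZ, le_of_psi_subset hZ⟩

/-- Every nested set of connected subsets of `Z` that contains `Z` comes from a construct. -/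
theorem exists_psi_eq (hZ : Z.Finite) {M : Set (Set α)} (hM : H.IsNested M) (hZM : Z ∈ M)
    (hMZ : ∀ A ∈ M, A ⊆ Z ∧ (H.restrict A).IsConnected) : ∃ T : H.Construct Z, T.psi = M := by
  induction hn : Z.ncard using Nat.strong_induction_on generalizing Z M with
  | _ n ih =>
  subst hn
  set Y := Z \ ⋃₀ (M \ {Z}) with hYdef
  have hsub : ⋃₀ (M \ {Z}) ⊆ Z := Set.sUnion_subset fun A hA => (hMZ A hA.1).1
  have hZY : Z \ Y = ⋃₀ (M \ {Z}) := Set.sdiff_sdiff_cancel_left hsub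
  have hY : Y ⊆ Z := Set.sdiff_subset
  have hne : Y.Nonempty := by
    refine Set.sdiff_nonempty.2 fun h => ?_
    have heq := hsub.antisymm h
    -- If the proper members covered `Z`, nestedness would make `Z` one of them.
    have := hM (M \ {Z}) Set.sdiff_subset (heq.symm ▸ (hMZ Z hZM).2)
    exact this.2 heq
  have hd := hZ.subset (Set.sdiff_subset (t := Y))
  have hmem : ∀ A ∈ M, A ≠ Z → A ⊆ Z \ Y := fun A hA hAZ =>
    hZY ▸ Set.subset_sUnion_of_mem (show A ∈ M \ {Z} from ⟨hA, hAZ⟩)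
  have hT : ∀ K, H.IsComponent (Z \ Y) K →
      ∃ T : H.Construct K, T.psi = {A | A ∈ M ∧ A ⊆ K} := by
    intro K hK
    have hKZ : K ⊂ Z := ⟨hK.subset.trans Set.sdiff_subset, fun h => by
      obtain ⟨y, hy⟩ := hne
      exact (hK.subset (h (hY hy))).2 hy⟩
    refine ih K.ncard (Set.ncard_lt_ncard hKZ hZ) (hd.subset hK.subset)
      (fun F hF => hM F fun A hA => (hF hA).1) ⟨?_, subset_rfl⟩
      (fun A hA => ⟨hA.2, (hMZ A hA.1).2⟩) rfl
    -- The members inside `K` cover the connected set `K`, so nestedness puts `K` itself in `M`.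
    have hU : ⋃₀ {A | A ∈ M ∧ A ⊆ K} = K := by
      refine (Set.sUnion_subset fun A hA => hA.2).antisymm fun x hx => ?_
      obtain ⟨A, hA, hxA⟩ : x ∈ ⋃₀ (M \ {Z}) := hZY ▸ hK.subset hx
      exact ⟨A, ⟨hA.1, hK.subset_of_inter_nonempty (hmem A hA.1 hA.2) (hMZ A hA.1).2
        ⟨x, hx, hxA⟩⟩, hxA⟩
    have := hM {A | A ∈ M ∧ A ⊆ K} (fun A hA => hA.1) (hU.symm ▸ hK.isConnected)
    rw [hU] at this
    exact this.1
  choose T hT using hT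
  refine ⟨node Y hY hne T, ?_⟩
  ext A
  rw [mem_psi_node hZ]
  constructor
  · rintro (rfl | ⟨K, hK, h⟩)
    · exact hZM
    · rw [hT] at h
      exact h.1
  · intro hA
    by_cases hAZ : A = Z
    · exact Or.inl hAZ
    · obtain ⟨K, hK, hAK⟩ := exists_isComponent_of_subset hd (hmem A hA hAZ) (hMZ A hA).2
      exact Or.inr ⟨K, hK, by rw [hT]; exact ⟨hA, hAK⟩⟩

end Construct

/-! ### Masses of sets and the growth of powers of three -/

/-- The sum of the coordinates of `x` with index in `A`. -/
noncomputable def mass (x : V(H) → ℝ) (A : Set α) : ℝ :=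
  ∑ᶠ i ∈ ((↑) ⁻¹' A : Set V(H)), x i

section Mass

variable {x y : V(H) → ℝ}

theorem mass_congr (h : ∀ i : V(H), (i : α) ∈ A → x i = y i) : mass x A = mass y A :=
  finsum_mem_congr rfl h

@[simp]
theorem mass_empty : mass x ∅ = 0 := by
  simp [mass]

theorem mass_singleton (i : V(H)) : mass x {(i : α)} = x i := by
  have : ((↑) ⁻¹' {(i : α)} : Set V(H)) = {i} := by
    ext j
    simp [Subtype.ext_iff]
  rw [mass, this, finsum_mem_singleton]

variable [Finite V(H)]

theorem mass_eq_sum (x : V(H) → ℝ) (A : Set α) :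
    mass x A = ∑ i ∈ (Set.toFinite ((↑) ⁻¹' A : Set V(H))).toFinset, x i :=
  finsum_mem_eq_finite_toFinset_sum _ _

theorem mass_union_add_inter : mass x (A ∪ B) + mass x (A ∩ B) = mass x A + mass x B :=
  finsum_mem_union_inter (Set.toFinite _) (Set.toFinite _)

theorem mass_union (h : Disjoint A B) : mass x (A ∪ B) = mass x A + mass x B := by
  rw [← mass_union_add_inter, h.inter_eq, mass_empty, add_zero]

theorem mass_nonneg (hx : ∀ i, 0 ≤ x i) : 0 ≤ mass x A :=
  mass_eq_sum x A ▸ Finset.sum_nonneg fun i _ => hx i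

theorem mass_mono (hx : ∀ i, 0 ≤ x i) (h : A ⊆ B) : mass x A ≤ mass x B := by
  rw [← Set.union_sdiff_cancel h, mass_union disjoint_sdiff_self_right]
  linarith [mass_nonneg (A := B \ A) hx]

theorem mass_add : mass (x + y) A = mass x A + mass y A :=
  finsum_mem_add_distrib (Set.toFinite _)

theorem mass_smul (c : ℝ) : mass (c • x) A = c * mass x A := by
  simp [mass_eq_sum, Finset.mul_sum]

theorem continuous_mass : Continuous fun x : V(H) → ℝ => mass x A := by
  simp_rw [mass_eq_sum]
  fun_prop

theorem mass_const (hA : A ⊆ V(H)) {c : ℝ} (h : ∀ i : V(H), (i : α) ∈ A → x i = c) :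
    mass x A = A.ncard * c := by
  rw [mass_eq_sum, Finset.sum_congr rfl fun i hi => h i (by simpa using hi), Finset.sum_const,
    nsmul_eq_mul, ← Set.ncard_eq_toFinset_card, Set.ncard_preimage_of_injective_subset_range Subtype.val_injective (by simpa using hA)]

/-- A union of sets `A` of mass `3 ^ |A|` has less than the corresponding mass, unless it is one of
these sets. -/
theorem mass_sUnion_lt (hx : ∀ i, 0 ≤ x i) {F : Set (Set α)} (hF : F.Finite)
    (hFV : ∀ A ∈ F, A ⊆ V(H)) (h : ∀ A ∈ F, mass x A = 3 ^ A.ncard) :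
    ⋃₀ F ∈ F ∨ mass x (⋃₀ F) < 3 ^ (⋃₀ F).ncard := by
  have hVfin : V(H).Finite := Set.toFinite _
  induction F, hF using Set.Finite.induction_on with
  | empty => simp
  | @insert A F hAF hF ih =>
    rw [Set.sUnion_insert]
    specialize ih (fun B hB => hFV B (Or.inr hB)) fun B hB => h B (Or.inr hB)
    have hAm := h A (Or.inl rfl)
    have hUV : A ∪ ⋃₀ F ⊆ V(H) :=
      Set.union_subset (hFV A (Or.inl rfl)) (Set.sUnion_subset fun B hB => hFV B (Or.inr hB))
    by_cases h₁ : A ⊆ ⋃₀ F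
    · rw [Set.union_eq_right.2 h₁]
      exact ih.imp_left Or.inr
    by_cases h₂ : ⋃₀ F ⊆ A
    · rw [Set.union_eq_left.2 h₂]
      exact Or.inl (Or.inl rfl)
    -- In the incomparable case both sets have at most `n` elements and the union has `n + 1`, so
    -- its mass is at most `2 * 3 ^ n`.
    right
    have hUm : mass x (⋃₀ F) ≤ 3 ^ (⋃₀ F).ncard := by
      rcases ih with ih | ih
      · exact (h _ (Or.inr ih)).le
      · exact ih.le
    have hc₁ : A.ncard < (A ∪ ⋃₀ F).ncard := Set.ncard_lt_ncard
      ⟨Set.subset_union_left, fun h => h₂ (Set.subset_union_right.trans h)⟩ (hVfin.subset hUV)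
    have hc₂ : (⋃₀ F).ncard < (A ∪ ⋃₀ F).ncard := Set.ncard_lt_ncard
      ⟨Set.subset_union_right, fun h => h₁ (Set.subset_union_left.trans h)⟩ (hVfin.subset hUV)
    obtain ⟨n, hn⟩ : ∃ n, (A ∪ ⋃₀ F).ncard = n + 1 := ⟨_, (Nat.succ_pred_eq_of_pos (by omega)).symm⟩
    rw [hn] at hc₁ hc₂ ⊢
    have hp₁ : (3 : ℝ) ^ A.ncard ≤ 3 ^ n := pow_le_pow_right₀ (by norm_num) (by omega)
    have hp₂ : (3 : ℝ) ^ (⋃₀ F).ncard ≤ 3 ^ n := pow_le_pow_right₀ (by norm_num) (by omega)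
    have hpos : (0 : ℝ) < 3 ^ n := by positivity
    have := mass_union_add_inter (x := x) (A := A) (B := ⋃₀ F)
    have := mass_nonneg (A := A ∩ ⋃₀ F) hx
    rw [pow_succ]
    linarith

end Mass

/-- Bernoulli's `1 + 2 * d ≤ 3 ^ d` gives `j ≤ j * 3 ^ d - (j + d)`; multiply by `3 ^ j > 1`. It
serves below with `j = |B ∩ Y|` and `j + d = |Y|`. -/
theorem mul_three_pow_add_lt {j d : ℕ} (hj : 0 < j) (hd : 0 < d) :
    ((j + d : ℕ) : ℝ) * 3 ^ j < j * (3 ^ (j + d) - 1) := by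
  have h₁ : 1 + 2 * (d : ℝ) ≤ 3 ^ d := by
    have := one_add_mul_le_pow (a := (2 : ℝ)) (by norm_num) d
    norm_num at this
    linarith
  have h₂ : (1 : ℝ) < 3 ^ j := one_lt_pow₀ (by norm_num) hj.ne'
  have hj' : (1 : ℝ) ≤ j := by exact_mod_cast hj
  have hd' : (1 : ℝ) ≤ d := by exact_mod_cast hd
  have h₃ : (j : ℝ) ≤ j * 3 ^ d - (j + d) := by nlinarith
  rw [pow_add]
  push_cast
  nlinarith

/-- The point is built from the leaves up: keep the points of the subtrees on their components and
spread the missing mass evenly over the root `Y`. A connected `B` avoiding `Y` lies in one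
component; if `B` meets `Y` and `B ≠ Z`, then `B ∩ Y` alone is already too heavy. -/
theorem exists_isolating_point [Finite V(H)] (hZ : Z ⊆ V(H)) (T : H.Construct Z) :
    ∃ x : V(H) → ℝ, (∀ i, 0 ≤ x i) ∧ (∀ B ∈ T.psi, mass x B = 3 ^ B.ncard) ∧
      ∀ B ⊆ Z, (H.restrict B).IsConnected → B ∉ T.psi → 3 ^ B.ncard < mass x B := by
  classical
  have hV : V(H).Finite := Set.toFinite _
  induction T with
  | @node Z Y hY hne T ih =>
  have hZf := hV.subset hZ
  have hKZ {K} (hK : H.IsComponent (Z \ Y) K) : K ⊆ Z := hK.subset.trans Set.sdiff_subset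
  have hd := hZf.subset (Set.sdiff_subset (t := Y))
  choose f hf0 hfpsi hflt using fun K hK => ih K hK ((hKZ hK).trans hZ)
  let g : V(H) → ℝ := fun i =>
    if h : ∃ K, H.IsComponent (Z \ Y) K ∧ (i : α) ∈ K then f h.choose h.choose_spec.1 i else 0
  have hg0 : ∀ i, 0 ≤ g i := by
    intro i
    simp only [g]
    split_ifs
    · exact hf0 _ _ _
    · rfl
  have hgK : ∀ K hK (i : V(H)), (i : α) ∈ K → g i = f K hK i := by
    intro K hK i hi
    have h : ∃ K, H.IsComponent (Z \ Y) K ∧ (i : α) ∈ K := ⟨K, hK, hi⟩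
    have heq : h.choose = K := h.choose_spec.1.eq_of_mem hK h.choose_spec.2 hi
    simp only [g, dif_pos h]
    congr
  have hgm : ∀ K hK, ∀ B ⊆ K, mass g B = mass (f K hK) B := fun K hK B hB =>
    mass_congr fun i hi => hgK K hK i (hB hi)
  set s := mass g (Z \ Y) with hs
  -- The components are tight for `g` and their union is `Z \ Y`.
  have hsle : s ≤ 3 ^ (Z \ Y).ncard := by
    have hU : ⋃₀ {K | H.IsComponent (Z \ Y) K} = Z \ Y := by
      refine (Set.sUnion_subset fun K hK => IsComponent.subset hK).antisymm fun i hi => ?_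
      obtain ⟨K, hK, hi⟩ := exists_isComponent_of_mem (H := H) hd hi
      exact ⟨K, hK, hi⟩
    have hm : ∀ K ∈ {K | H.IsComponent (Z \ Y) K}, mass g K = 3 ^ K.ncard := fun K hK => by
      rw [hgm K hK K subset_rfl,
        hfpsi K hK K (Construct.self_mem_psi (hd.subset (IsComponent.subset hK)) _)]
    have := mass_sUnion_lt (F := {K | H.IsComponent (Z \ Y) K}) hg0 (hd.finite_subsets.subset fun K hK => IsComponent.subset hK)
      (fun K hK => (hKZ hK).trans hZ) hm
    rw [hU] at this
    rcases this with h | h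
    · exact (hm _ h).le
    · exact h.le
  have hk : 0 < Y.ncard := (Set.ncard_pos (hZf.subset hY)).2 hne
  have hcard : (Z \ Y).ncard + Y.ncard = Z.ncard := Set.ncard_sdiff_add_ncard_of_subset hY hZf
  have hk' : (0 : ℝ) < Y.ncard := by exact_mod_cast hk
  have hsZ : s ≤ 3 ^ (Z.ncard - 1) :=
    hsle.trans (pow_le_pow_right₀ (by norm_num) (by omega))
  have hpZ : (3 : ℝ) ^ Z.ncard = 3 * 3 ^ (Z.ncard - 1) := by
    rw [← pow_succ']
    congr 1
    omega
  have hpos : (0 : ℝ) < 3 ^ (Z.ncard - 1) := by positivity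
  -- The common coordinate on `Y` that gives `Z` total mass `3 ^ |Z|`.
  obtain ⟨w, hw⟩ : ∃ w : ℝ, Y.ncard * w = 3 ^ Z.ncard - s := ⟨(3 ^ Z.ncard - s) / Y.ncard, by
    field_simp⟩
  have hw0 : 0 < w := by
    refine pos_of_mul_pos_right (a := (Y.ncard : ℝ)) ?_ hk'.le
    rw [hw]
    linarith
  let x : V(H) → ℝ := fun i => if (i : α) ∈ Y then w else g i
  have hx0 : ∀ i, 0 ≤ x i := by
    intro i
    simp only [x]
    split_ifs
    · exact hw0.le
    · exact hg0 i
  have hxY : ∀ B ⊆ Y, mass x B = B.ncard * w := fun B hB =>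
    mass_const ((hB.trans hY).trans hZ) fun i hi => if_pos (hB hi)
  have hxd : ∀ B ⊆ Z \ Y, mass x B = mass g B := fun B hB =>
    mass_congr fun i hi => if_neg (hB hi).2
  have hxK : ∀ K hK, ∀ B ⊆ K, mass x B = mass (f K hK) B := fun K hK B hB => by
    rw [hxd B (hB.trans hK.subset), hgm K hK B hB]
  refine ⟨x, hx0, fun B hB => ?_, fun B hBZ hB hBpsi => ?_⟩
  · rcases (Construct.mem_psi_node hZf).1 hB with rfl | ⟨K, hK, hB⟩
    · rw [← Set.union_sdiff_cancel hY, mass_union disjoint_sdiff_self_right,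
        Set.union_sdiff_cancel hY, hxY Y subset_rfl, hw, hxd _ subset_rfl]
      ring
    · rw [hxK K hK B (Construct.subset_of_mem_psi (hd.subset hK.subset) hB), hfpsi K hK B hB]
  · rw [Construct.mem_psi_node hZf] at hBpsi
    push Not at hBpsi
    by_cases hBY : (B ∩ Y).Nonempty
    · have hBf := hZf.subset hBZ
      have hBcard : B.ncard < Z.ncard :=
        Set.ncard_lt_ncard (hBZ.ssubset_of_ne hBpsi.1) hZf
      have hjk : (B ∩ Y).ncard ≤ Y.ncard :=
        Set.ncard_le_ncard Set.inter_subset_right (hZf.subset hY)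
      have hj : 0 < (B ∩ Y).ncard := (Set.ncard_pos (hBf.subset Set.inter_subset_left)).2 hBY
      have hbj : B.ncard ≤ (Z \ Y).ncard + (B ∩ Y).ncard := by
        rw [← Set.ncard_inter_add_ncard_sdiff_eq_ncard B Y hBf, add_comm]
        gcongr
      refine lt_of_lt_of_le ?_ (mass_mono hx0 (Set.inter_subset_left (s := B) (t := Y)))
      rw [hxY _ Set.inter_subset_right]
      generalize (B ∩ Y).ncard = j at *
      -- If `Y ⊆ B`, the mass on `Y` is at least `2 * 3 ^ (|Z| - 1)`, while `|B| < |Z|`. Otherwise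
      -- `mul_three_pow_add_lt` applies after scaling by `3 ^ |Z \ Y|`.
      rcases hjk.eq_or_lt with rfl | hjk
      · rw [hw]
        have : (3 : ℝ) ^ B.ncard ≤ 3 ^ (Z.ncard - 1) :=
          pow_le_pow_right₀ (by norm_num) (by omega)
        linarith
      · obtain ⟨d, hd⟩ := Nat.exists_eq_add_of_lt hjk
        have h₁ := mul_three_pow_add_lt hj d.succ_pos
        rw [show j + d.succ = Y.ncard from hd.symm] at h₁
        refine lt_of_mul_lt_mul_left ?_ hk'.le
        have h₂ : (3 : ℝ) ^ B.ncard ≤ 3 ^ (Z \ Y).ncard * 3 ^ j := by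
          rw [← pow_add]
          exact pow_le_pow_right₀ (by norm_num) hbj
        have h₃ : (3 : ℝ) ^ Z.ncard = 3 ^ (Z \ Y).ncard * 3 ^ Y.ncard := by
          rw [← pow_add, hcard]
        have hj' : (0 : ℝ) < j := by exact_mod_cast hj
        calc (Y.ncard : ℝ) * 3 ^ B.ncard ≤ Y.ncard * (3 ^ (Z \ Y).ncard * 3 ^ j) := by gcongr
          _ = 3 ^ (Z \ Y).ncard * (Y.ncard * 3 ^ j) := by ring
          _ < 3 ^ (Z \ Y).ncard * (j * (3 ^ Y.ncard - 1)) := by gcongr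
          _ = j * (3 ^ Z.ncard - 3 ^ (Z \ Y).ncard) := by rw [h₃]; ring
          _ ≤ j * (3 ^ Z.ncard - s) := by gcongr
          _ = Y.ncard * (j * w) := by rw [← hw]; ring
    · have hBd : B ⊆ Z \ Y := fun i hi => ⟨hBZ hi, fun h => hBY ⟨i, hi, h⟩⟩
      obtain ⟨K, hK, hBK⟩ := exists_isComponent_of_subset hd hBd hB
      rw [hxK K hK B hBK]
      exact hflt K hK B hBK hB (hBpsi.2 K hK)

/-! ### Tight families and exposed faces -/

/-- The connected sets `A` such that `x` lies on the hyperplane of `A`. -/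
def tight (x : V(H) → ℝ) : Set (Set α) :=
  {A | A ∈ H.Sat ∧ mass x A = 3 ^ A.ncard}

section Realization

variable {x y : V(H) → ℝ}

theorem mem_sat_iff : A ∈ H.Sat ↔ A ⊆ V(H) ∧ (H.restrict A).IsConnected :=
  ⟨fun h => h.2, fun h => ⟨h.2.1, h⟩⟩

theorem mem_realization_iff : x ∈ H.realization ↔
    mass x V(H) = 3 ^ V(H).ncard ∧ ∀ A ∈ H.Sat, 3 ^ A.ncard ≤ mass x A := by
  simp only [realization, Set.mem_inter_iff, Set.mem_iInter]
  constructor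
  · rintro ⟨h₁, h₂⟩
    refine ⟨h₂, fun A hA => ?_⟩
    by_cases hAV : A = V(H)
    · rw [hAV]
      exact h₂.ge
    · exact h₁ A ⟨hA, hAV⟩
  · exact fun h => ⟨fun A hA => h.2 A hA.1, h.1⟩

theorem mem_geomFace_iff {M : Set (Set α)} (hM : M ⊆ H.Sat) :
    x ∈ H.geomFace M ↔ x ∈ H.realization ∧ M ⊆ tight x := by
  simp only [geomFace, Set.mem_inter_iff, Set.mem_iInter]
  exact ⟨fun h => ⟨h.2, fun A hA => ⟨hM hA, h.1 A hA⟩⟩, fun h => ⟨fun A hA => (h.2 hA).2, h.1⟩⟩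

theorem restrict_vertexSet : H.restrict V(H) = H := by
  ext
  · rfl
  · exact ⟨fun h => h.1, fun h => ⟨h, H.subset_vertexSet_of_mem_edgeSet h⟩⟩

theorem nonneg_of_mem_realization (hx : x ∈ H.realization) (i : V(H)) : 0 ≤ x i := by
  have := (mem_realization_iff.1 hx).2 {(i : α)}
    (mem_sat_iff.2 ⟨Set.singleton_subset_iff.2 i.2, isConnected_restrict_singleton _⟩)
  rw [mass_singleton] at this
  exact le_trans (by positivity) this

variable [Finite V(H)]

theorem finite_sat : H.Sat.Finite :=
  (Set.toFinite V(H)).finite_subsets.subset fun _ hA => hA.2.1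

theorem finite_tight : (tight x).Finite :=
  finite_sat.subset fun _ hA => hA.1

/-- A connected union obeys its own half-space inequality, which excludes the strict alternative of
`mass_sUnion_lt`. -/
theorem isNested_tight (hx : x ∈ H.realization) : H.IsNested (tight x) := by
  intro F hF hc
  have hFV : ∀ A ∈ F, A ⊆ V(H) := fun A hA => (hF hA).1.2.1
  refine (mass_sUnion_lt (nonneg_of_mem_realization hx) (finite_tight.subset hF) hFV
    fun A hA => (hF hA).2).resolve_right fun h => h.not_ge ?_
  exact (mem_realization_iff.1 hx).2 _ (mem_sat_iff.2 ⟨Set.sUnion_subset hFV, hc⟩)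

theorem exists_tight_eq_psi (hc : H.IsConnected) (T : H.Construct V(H)) :
    ∃ x ∈ H.realization, tight x = T.psi := by
  have hV : V(H).Finite := Set.toFinite _
  have hcV : (H.restrict V(H)).IsConnected := by
    rwa [restrict_vertexSet]
  obtain ⟨x, hx0, hx, hlt⟩ := exists_isolating_point subset_rfl T
  refine ⟨x, mem_realization_iff.2 ⟨hx _ (T.self_mem_psi hV), fun A hA => ?_⟩, ?_⟩
  · by_cases h : A ∈ T.psi
    · exact (hx A h).ge
    · exact (hlt A hA.2.1 hA.2.2 h).le
  · ext A
    refine ⟨fun h => ?_, fun h => ⟨mem_sat_iff.2 ⟨Construct.subset_of_mem_psi hV h,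
      Construct.isConnected_of_mem_psi hV hcV h⟩, hx A h⟩⟩
    by_contra hA
    exact (hlt A h.1.2.1 h.1.2.2 hA).ne' h.2

/-- The midpoint of two points of the realization is tight where both points are. -/
theorem tight_midpoint (hx : x ∈ H.realization) (hy : y ∈ H.realization) :
    tight ((1 / 2 : ℝ) • (x + y)) ⊆ tight x ∩ tight y := by
  rintro A ⟨hA, h⟩
  rw [mass_smul, mass_add] at h
  have h₁ := (mem_realization_iff.1 hx).2 A hA
  have h₂ := (mem_realization_iff.1 hy).2 A hA
  exact ⟨⟨hA, by linarith⟩, ⟨hA, by linarith⟩⟩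

theorem midpoint_mem_realization (hx : x ∈ H.realization) (hy : y ∈ H.realization) :
    (1 / 2 : ℝ) • (x + y) ∈ H.realization := by
  rw [mem_realization_iff] at *
  refine ⟨?_, fun A hA => ?_⟩
  · rw [mass_smul, mass_add, hx.1, hy.1]
    ring
  · have h₁ := hx.2 A hA
    have h₂ := hy.2 A hA
    rw [mass_smul, mass_add]
    linarith

/-- A segment of the realization can be prolonged beyond an end point that is on no hyperplane
other than those of the other end point. -/
theorem exists_prolongation_mem_realization (hx : x ∈ H.realization) (hy : y ∈ H.realization)
    (hxy : tight x ⊆ tight y) : ∃ ε > (0 : ℝ), x + ε • (x - y) ∈ H.realization := by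
  have hmass (ε : ℝ) (A : Set α) :
      mass (x + ε • (x - y)) A = mass x A + ε * (mass x A - mass y A) := by
    rw [mass_add, mass_smul, sub_eq_add_neg, mass_add, ← neg_one_smul ℝ y, mass_smul]
    ring
  -- Constraints tight at `x` are tight at `y`, hence constant along the line; the finitely many
  -- others are strict at `x` and survive for small `ε`.
  have hev : ∀ᶠ ε in nhdsWithin (0 : ℝ) (Set.Ioi 0),
      ∀ A ∈ H.Sat, 3 ^ A.ncard ≤ mass (x + ε • (x - y)) A := by
    refine (Set.Finite.eventually_all finite_sat).2 fun A hA => ?_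
    by_cases hAx : A ∈ tight x
    · refine Filter.Eventually.of_forall fun ε => ?_
      rw [hmass, hAx.2, (hxy hAx).2, sub_self, mul_zero, add_zero]
    · have hlt : 3 ^ A.ncard < mass x A :=
        lt_of_le_of_ne ((mem_realization_iff.1 hx).2 A hA) fun h => hAx ⟨hA, h.symm⟩
      have hcont : Continuous fun ε : ℝ => mass x A + ε * (mass x A - mass y A) := by fun_prop
      refine nhdsWithin_le_nhds ?_
      have h0 : 3 ^ A.ncard < mass x A + 0 * (mass x A - mass y A) := by simpa using hlt
      filter_upwards [hcont.continuousAt.eventually_const_lt h0] with ε hε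
      rw [hmass]
      exact hε.le
  obtain ⟨ε, h, hε⟩ := (hev.and self_mem_nhdsWithin).exists
  refine ⟨ε, hε, mem_realization_iff.2 ⟨?_, h⟩⟩
  rw [hmass, (mem_realization_iff.1 hx).1, (mem_realization_iff.1 hy).1]
  ring

/-- The sum of the masses over `M` is at least the sum of the bounds, with equality exactly when
every `A ∈ M` is tight. The point `z` shows that equality is attained; the sign turns this minimum
into a maximum. -/
theorem isExposed_geomFace {M : Set (Set α)} (hM : M ⊆ H.Sat) :
    IsExposed ℝ H.realization (H.geomFace M) := by
  rintro ⟨z, hz⟩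
  have hMfin := finite_sat.subset hM
  let m (A : Set α) : StrongDual ℝ (V(H) → ℝ) :=
    { toFun := fun x => mass x A
      map_add' := fun _ _ => mass_add
      map_smul' := fun _ _ => mass_smul _
      cont := continuous_mass }
  refine ⟨-∑ A ∈ hMfin.toFinset, m A, ?_⟩
  have hl (x : V(H) → ℝ) : (-∑ A ∈ hMfin.toFinset, m A) x = -∑ A ∈ hMfin.toFinset, mass x A := by
    simp [m]
  simp_rw [hl, neg_le_neg_iff]
  rw [mem_geomFace_iff hM] at hz
  have hle : ∀ y ∈ H.realization, ∀ A ∈ hMfin.toFinset, (3 : ℝ) ^ A.ncard ≤ mass y A :=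
    fun y hy A hA => (mem_realization_iff.1 hy).2 A (hM (hMfin.mem_toFinset.1 hA))
  have hzM : ∑ A ∈ hMfin.toFinset, mass z A = ∑ A ∈ hMfin.toFinset, (3 : ℝ) ^ A.ncard :=
    Finset.sum_congr rfl fun A hA => (hz.2 (hMfin.mem_toFinset.1 hA)).2
  ext x
  rw [mem_geomFace_iff hM]
  refine and_congr_right fun hx => ⟨fun h y hy => ?_, fun h A hA => ⟨hM hA, ?_⟩⟩
  · rw [Finset.sum_congr rfl fun A hA => (h (hMfin.mem_toFinset.1 hA)).2]
    exact Finset.sum_le_sum (hle y hy)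
  · have hsum := (Finset.sum_eq_sum_iff_of_le (hle x hx)).1
      ((Finset.sum_le_sum (hle x hx)).antisymm (hzM ▸ h z hz.1))
    exact (hsum A (hMfin.mem_toFinset.2 hA)).symm

/-- The exposed faces are the sets cut out by the hyperplanes through one of their points. -/
theorem exists_eq_geomFace {F : Set (V(H) → ℝ)} (hne : F.Nonempty)
    (hF : IsExposed ℝ H.realization F) :
    ∃ x ∈ H.realization, F = H.geomFace (tight x) := by
  obtain ⟨l, hl⟩ := hF hne
  have hsub : F ⊆ H.realization := hF.subset
  -- A point with fewest tight sets plays the role of a relative interior point of `F`.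
  obtain ⟨x, hxF, hmin⟩ : ∃ x ∈ F, ∀ y ∈ F, (tight x).ncard ≤ (tight y).ncard := by
    obtain ⟨x, hx⟩ := exists_minimalFor_of_wellFoundedLT (· ∈ F) (fun x => (tight x).ncard) hne
    exact ⟨x, hx.1, fun y hy => le_of_not_gt fun h => h.not_ge (hx.2 hy h.le)⟩
  have hx := hsub hxF
  have hxl : ∀ y ∈ H.realization, l y ≤ l x := by
    rw [hl] at hxF
    exact hxF.2
  refine ⟨x, hx, ?_⟩
  ext y
  rw [mem_geomFace_iff fun A hA => hA.1]
  constructor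
  · intro hyF
    have hy := hsub hyF
    have hyl : ∀ z ∈ H.realization, l z ≤ l y := by
      rw [hl] at hyF
      exact hyF.2
    have hmF : (1 / 2 : ℝ) • (x + y) ∈ F := by
      rw [hl]
      refine ⟨midpoint_mem_realization hx hy, fun z hz => ?_⟩
      rw [map_smul, map_add, smul_eq_mul]
      linarith [hxl z hz, hyl z hz]
    have hm := tight_midpoint hx hy
    -- By minimality the midpoint has the same tight family as `x`, so everything tight at `x` is
    -- tight at `y`.
    have heq := Set.eq_of_subset_of_ncard_le (fun A hA => (hm hA).1) (hmin _ hmF) finite_tight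
    exact ⟨hy, heq ▸ fun A hA => (hm hA).2⟩
  · rintro ⟨hy, hxy⟩
    -- As `l` is maximal at `x`, its value beyond `x` on the line from `y` cannot be larger; hence
    -- `l x ≤ l y`.
    obtain ⟨ε, hε, hmem⟩ := exists_prolongation_mem_realization hx hy hxy
    rw [hl]
    refine ⟨hy, fun z hz => (hxl z hz).trans ?_⟩
    have := hxl _ hmem
    rw [map_add, map_smul, map_sub, smul_eq_mul] at this
    nlinarith

theorem self_mem_tight (hc : H.IsConnected) (hx : x ∈ H.realization) : V(H) ∈ tight x :=
  ⟨mem_sat_iff.2 ⟨subset_rfl, by rwa [restrict_vertexSet]⟩, (mem_realization_iff.1 hx).1⟩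

end Realization

end Hypergraph

/-! ### The order isomorphism -/

theorem mainTheorem1 {α : Type*} (H : Hypergraph α) (hfin : V(H).Finite) (hne : ∅ ∉ E(H))
    (hatomic : H.IsAtomic) (hconn : H.IsConnected) :
    IsPartialOrder (H.Construct V(H)) (· ≤ ·) ∧
      ∃ e : H.Construct V(H) ≃o H.Face,
        ∀ T : H.Construct V(H), (e T : Set (V(H) → ℝ)) = H.geomFace T.psi := by
  have : Finite V(H) := hfin
  choose p hpmem hptight using Hypergraph.exists_tight_eq_psi hconn
  have hsat (T : H.Construct V(H)) : T.psi ⊆ H.Sat := fun A hA => by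
    rw [← hptight T] at hA
    exact hA.1
  have hp (T : H.Construct V(H)) : p T ∈ H.geomFace T.psi :=
    (Hypergraph.mem_geomFace_iff (hsat T)).2 ⟨hpmem T, (hptight T).ge⟩
  have hle (S T : H.Construct V(H)) : H.geomFace S.psi ⊆ H.geomFace T.psi ↔ S ≤ T := by
    rw [Hypergraph.Construct.le_iff_psi_subset hfin]
    constructor
    · intro h
      -- The point `p S` is tight exactly on `S.psi`, so its lying in the face of `T` forces `T.psi
      -- ⊆ S.psi`.
      rw [← hptight S]
      exact ((Hypergraph.mem_geomFace_iff (hsat T)).1 (h (hp S))).2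
    · intro h x hx
      rw [Hypergraph.mem_geomFace_iff (hsat _)] at hx ⊢
      exact ⟨hx.1, h.trans hx.2⟩
  -- Antisymmetry is not part of `Le`; it comes from the injectivity of `psi`.
  have hanti (S T : H.Construct V(H)) (hST : S ≤ T) (hTS : T ≤ S) : S = T := by
    rw [Hypergraph.Construct.le_iff_psi_subset hfin] at hST hTS
    exact Hypergraph.Construct.psi_injective hfin (hTS.antisymm hST)
  let f (T : H.Construct V(H)) : H.Face :=
    ⟨H.geomFace T.psi, ⟨p T, hp T⟩, Hypergraph.isExposed_geomFace (hsat T)⟩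
  have hf : Function.Bijective f := by
    refine ⟨fun S T h => ?_, fun ⟨F, hFne, hF⟩ => ?_⟩
    · have h : H.geomFace S.psi = H.geomFace T.psi := congrArg Subtype.val h
      exact hanti S T ((hle S T).1 h.subset) ((hle T S).1 h.superset)
    · obtain ⟨x, hx, rfl⟩ := Hypergraph.exists_eq_geomFace hFne hF
      obtain ⟨T, hT⟩ := Hypergraph.Construct.exists_psi_eq hfin (Hypergraph.isNested_tight hx)
        (Hypergraph.self_mem_tight hconn hx) fun A hA => Hypergraph.mem_sat_iff.1 hA.1
      exact ⟨T, Subtype.ext (congrArg H.geomFace hT)⟩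
  exact ⟨{ refl := le_refl, trans := fun _ _ _ => le_trans, antisymm := hanti },
    { toEquiv := Equiv.ofBijective f hf, map_rel_iff' := fun {S T} => hle S T }, fun _ => rfl⟩
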